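/- Let $I\ge 0$ and $K\ge 1$. Let $f_1,\dots,f_I$ be distinct quadratic polynomials with integer coefficients, irreducible over $\mathbb{Q}$, and let $D_i$ be the discriminant of $f_i$. Let $g_k(n)=a_kn+b_k$, $1\le k\le K$, be distinct linear polynomials with non-zero, relatively prime integer coefficients $a_k,b_k$, such that $g_k(n)\neq 0$ for every integer $n\ge 1$. Suppose that 1. $$J'_f := 1+\sum_{\substack{\varnothing\neq J\subseteq\{1,\dots,I\}\\ \prod_{j\in J}D_j\text{ is a perfect square}}}(-1)^{|J|}\neq 0;$$ 2. $a_1>0$ and $a_1\ge |a_k|$ for all $1<k\le K$; 3. $a_1$ is relatively prime to $\prod_{i=1}^I D_i$; 4. for every $k>1$ with $|a_k|=a_1$ one has $b_1\not\equiv \operatorname{sgn}(a_k)\,b_k \pmod{a_1}$; that is, $b_1\not\equiv b_k$ if $a_k=a_1$, and $b_1\not\equiv -b_k$ if $a_k=-a_1$. Then $$N_x=\prod_{1\le n\le x}\left(\prod_{i=1}^I f_i(n)\right)\left(\prod_{k=1}^K g_k(n)\right)$$ is a perfect square for only finitely many integers $x\ge 1$. -/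

import Mathlib

open Polynomial

/-- `1 + ∑ (-1)^|J|`, the sum being over the non-empty sets `J` of indices for which
`∏ j ∈ J, D j` is a perfect square. -/
def squareSubsetSum {I : ℕ} (D : Fin I → ℤ) : ℤ :=
  1 + ∑ J ∈ (Finset.univ : Finset (Finset (Fin I))) with
    J.Nonempty ∧ IsSquare (∏ j ∈ J, D j), (-1 : ℤ) ^ J.card

/-- `N_x = ∏_{1 ≤ n ≤ x} (∏ i, f i (n)) (∏ k, g k (n))`. -/
noncomputable def productUpTo {I K : ℕ} (f : Fin I → ℤ[X]) (g : Fin K → ℤ[X]) (x : ℕ) : ℤ :=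
  ∏ n ∈ Finset.Icc 1 x, (∏ i, (f i).eval (n : ℤ)) * ∏ k, (g k).eval (n : ℤ)

/-! For every large `x` some prime `p` divides `N_x` exactly once. Take `p` slightly below `a 0 * x
+ b 0`, with `p ≡ b 0` modulo `a 0` and every discriminant a nonresidue modulo `p`. Completing the
square shows that `p` divides no value of any `f i`. By size, `p ∣ g k (n)` with `n ≤ x` forces `|a
k| = a 0` and `g k (n) = ± p` with the sign of `a k`; the congruence hypothesis then leaves only `k
= 0` and `n = (p - b 0) / a 0` (`abs_eq_and_eq_of_dvd_linear`).

A suitable residue class exists by a character count (`exists_unit_forall_jacobiSym_eq_neg_one`).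
Sum `∏ (1 - χ_i(c))` over the unit classes `c` lying above `b 0`. A nonsquare subproduct contributes
zero, because its character takes the value `-1` at a class that is `1` modulo `a 0`; a square one
contributes its sign. The total is a nonzero multiple of `squareSubsetSum`.

Primes of that class in every window `[X e^(-ε), X e^ε]` come from a Wiener–Ikehara argument
(`exists_eventually_le_sum_window`): Fejér smoothing, continuity of the pole-free L-function on `Re
s ≥ 1`, and a Chebyshev bound. A positive lower bound for the window suffices, so no asymptotic
formula is proved. -/

/-! ### The Fejér kernel: positivity and size. -/

/-- The cosine transform of the triangle function on `[0, l]`. -/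
noncomputable def fejer (l u : ℝ) : ℝ := ∫ t in (0 : ℝ)..l, (1 - t / l) * Real.cos (t * u)

lemma fejer_eq {l u : ℝ} (hl : 0 < l) (hu : u ≠ 0) :
    fejer l u = (1 - Real.cos (l * u)) / (l * u ^ 2) := by
  have hd : ∀ t ∈ Set.uIcc 0 l, HasDerivAt
      (fun t ↦ (1 - t / l) * (Real.sin (t * u) / u) - Real.cos (t * u) / (l * u ^ 2))
      ((1 - t / l) * Real.cos (t * u)) t := by
    intro t _
    have h0 : HasDerivAt (fun t ↦ t * u) u t := by simpa using (hasDerivAt_id t).mul_const u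
    have h1 : HasDerivAt (fun t ↦ 1 - t / l) (-(1 / l)) t := by
      simpa using ((hasDerivAt_id t).div_const l).const_sub 1
    have h2 := h0.sin.div_const u
    have h3 := h0.cos.div_const (l * u ^ 2)
    refine ((h1.mul h2).sub h3).congr_deriv ?_
    field_simp
    ring
  rw [fejer, intervalIntegral.integral_eq_sub_of_hasDerivAt hd
    (Continuous.intervalIntegrable (by fun_prop) _ _)]
  simp
  field_simp
  ring

lemma fejer_nonneg {l : ℝ} (hl : 0 < l) (u : ℝ) : 0 ≤ fejer l u := by
  rcases eq_or_ne u 0 with rfl | hu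
  · refine intervalIntegral.integral_nonneg hl.le fun t ht ↦ ?_
    have : t / l ≤ 1 := (div_le_one hl).2 ht.2
    simpa using this
  · rw [fejer_eq hl hu]
    have := Real.cos_le_one (l * u)
    have : 0 ≤ 1 - Real.cos (l * u) := by linarith
    positivity

lemma fejer_le {l : ℝ} (hl : 0 < l) (u : ℝ) : fejer l u ≤ l := by
  have := intervalIntegral.norm_integral_le_of_norm_le_const (a := 0) (b := l) (C := 1)
    (f := fun t ↦ (1 - t / l) * Real.cos (t * u)) fun t ht ↦ by
      rw [Set.uIoc_of_le hl.le] at ht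
      have h1 : t / l ≤ 1 := (div_le_one hl).2 ht.2
      have h2 : 0 ≤ t / l := div_nonneg ht.1.le hl.le
      rw [norm_mul, Real.norm_eq_abs, Real.norm_eq_abs, ← one_mul (1 : ℝ)]
      exact mul_le_mul (by rw [abs_le]; constructor <;> linarith) (Real.abs_cos_le_one _)
        (abs_nonneg _) zero_le_one
  simp only [one_mul, sub_zero, abs_of_pos hl] at this
  exact (le_abs_self _).trans this

lemma fejer_le_of_ne {l u : ℝ} (hl : 0 < l) (hu : u ≠ 0) : fejer l u ≤ 2 / (l * u ^ 2) := by
  rw [fejer_eq hl hu]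
  have := Real.neg_one_le_cos (l * u)
  gcongr
  linarith

lemma le_fejer {l u : ℝ} (hl : 0 < l) (hu : u ≠ 0) (hlu : |l * u| ≤ 1) : l / 8 ≤ fejer l u := by
  rw [fejer_eq hl hu, le_div_iff₀ (by positivity)]
  have h := (abs_le.1 (Real.cos_bound hlu)).2
  have h4 : |l * u| ^ 4 ≤ (l * u) ^ 2 := by
    rw [← sq_abs (l * u)]
    exact pow_le_pow_of_le_one (abs_nonneg _) hlu (by norm_num)
  nlinarith [sq_nonneg (l * u)]

/-! ### Fejér-weighted Dirichlet series and their boundary behaviour. -/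

open Filter Topology MeasureTheory in
/-- Riemann–Lebesgue for the truncated transform. -/
lemma tendsto_integral_exp_mul_atTop (l : ℝ) (F : ℝ → ℂ) (hl : 0 ≤ l) :
    Tendsto (fun y : ℝ ↦ ∫ t in (0 : ℝ)..l, Complex.exp (t * y * Complex.I) * F t)
      atTop (𝓝 0) := by
  have h := Real.tendsto_integral_exp_smul_cocompact ((Set.Ioc 0 l).indicator F)
  have h2 : Tendsto (fun y : ℝ ↦ -y / (2 * Real.pi)) atTop (cocompact ℝ) := by
    have : Tendsto (fun y : ℝ ↦ -y / (2 * Real.pi)) atTop atBot :=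
      (tendsto_neg_atTop_atBot).atBot_div_const (by positivity)
    exact this.mono_right atBot_le_cocompact
  refine (h.comp h2).congr fun y ↦ ?_
  rw [intervalIntegral.integral_of_le hl, ← integral_indicator measurableSet_Ioc]
  refine integral_congr_ae (ae_of_all _ fun t ↦ ?_)
  by_cases ht : t ∈ Set.Ioc 0 l
  · simp only [Set.indicator_of_mem ht, Circle.smul_def, Real.fourierChar_apply, smul_eq_mul]
    congr 2
    push_cast
    field_simp
  · simp [Set.indicator_of_notMem ht]

lemma re_exp_mul_term (c : ℕ → ℝ) {n : ℕ} (hn : n ≠ 0) (σ t y : ℝ) :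
    (Complex.exp (t * y * Complex.I) *
      LSeries.term (fun n ↦ (c n : ℂ)) (σ + t * Complex.I) n).re =
      c n / (n : ℝ) ^ σ * Real.cos (t * (Real.log n - y)) := by
  have hn0 : (n : ℂ) ≠ 0 := mod_cast hn
  have hnpos : (0 : ℝ) < n := by positivity
  have h1 : (n : ℂ) ^ ((σ : ℂ) + t * Complex.I) =
      (((n : ℝ) ^ σ : ℝ) : ℂ) * Complex.exp (t * Real.log n * Complex.I) := by
    rw [Complex.cpow_add _ _ hn0, Complex.ofReal_cpow hnpos.le, Complex.ofReal_natCast,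
      Complex.cpow_def_of_ne_zero hn0 (t * Complex.I), Complex.natCast_log]
    congr 2
    ring
  rw [LSeries.term_of_ne_zero hn, h1]
  have h2 : Complex.exp (t * y * Complex.I) *
      ((c n : ℂ) / ((((n : ℝ) ^ σ : ℝ) : ℂ) * Complex.exp (t * Real.log n * Complex.I))) =
      ((c n / (n : ℝ) ^ σ : ℝ) : ℂ) *
        Complex.exp (((-(t * (Real.log n - y)) : ℝ) : ℂ) * Complex.I) := by
    have h3 : Complex.exp (((-(t * (Real.log n - y)) : ℝ) : ℂ) * Complex.I) =
        Complex.exp (t * y * Complex.I) / Complex.exp (t * Real.log n * Complex.I) := by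
      rw [← Complex.exp_sub]
      congr 1
      push_cast
      ring
    rw [h3]
    push_cast
    rw [mul_div_assoc', div_mul_div_comm, mul_comm (Complex.exp _)]
  rw [h2, Complex.re_ofReal_mul, Complex.exp_ofReal_mul_I_re, Real.cos_neg]

-- Integrating the Dirichlet series termwise against the triangle function turns each oscillation
-- `n^(-it)` into a kernel centred at `y` on the logarithmic scale.
open MeasureTheory in
lemma hasSum_mul_fejer {c : ℕ → ℝ} {H : ℂ → ℂ} {σ l : ℝ} (hσ : σ ≠ 0) (hl : 0 < l) (y : ℝ)
    (hs : ∀ t : ℝ, HasSum (LSeries.term (fun n ↦ (c n : ℂ)) (σ + t * Complex.I))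
      (H (σ + t * Complex.I)))
    (hc : Summable fun n ↦ |c n| / (n : ℝ) ^ σ) :
    HasSum (fun n : ℕ ↦ c n / (n : ℝ) ^ σ * fejer l (Real.log n - y))
      (∫ t in (0 : ℝ)..l,
        (1 - t / l) * (Complex.exp (t * y * Complex.I) * H (σ + t * Complex.I)).re) := by
  have key := intervalIntegral.hasSum_integral_of_dominated_convergence (μ := volume)
    (a := 0) (b := l)
    (F := fun (n : ℕ) t ↦ c n / (n : ℝ) ^ σ * ((1 - t / l) * Real.cos (t * (Real.log n - y))))
    (f := fun t ↦ (1 - t / l) * (Complex.exp (t * y * Complex.I) * H (σ + t * Complex.I)).re)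
    (fun n _ ↦ |c n| / (n : ℝ) ^ σ)
    (fun n ↦ Continuous.aestronglyMeasurable (by fun_prop)) ?_ (ae_of_all _ fun _ _ ↦ hc)
    (by simp) ?_
  · simpa only [intervalIntegral.integral_const_mul, fejer] using key
  · refine fun n ↦ ae_of_all _ fun t ht ↦ ?_
    rw [Set.uIoc_of_le hl.le] at ht
    have h1 : t / l ≤ 1 := (div_le_one hl).2 ht.2
    have h2 : 0 ≤ t / l := div_nonneg ht.1.le hl.le
    have h3 : |(1 - t / l) * Real.cos (t * (Real.log n - y))| ≤ 1 * 1 := by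
      rw [abs_mul]
      exact mul_le_mul (by rw [abs_le]; constructor <;> linarith) (Real.abs_cos_le_one _)
        (abs_nonneg _) zero_le_one
    rw [Real.norm_eq_abs, abs_mul, abs_div, abs_of_nonneg (by positivity : 0 ≤ (n : ℝ) ^ σ)]
    exact (mul_le_mul_of_nonneg_left h3 (by positivity)).trans (by simp)
  · refine ae_of_all _ fun t _ ↦ ?_
    have h1 := (hs t).mul_left (Complex.exp (t * y * Complex.I))
    have h2 := (Complex.hasSum_re h1).mul_left (1 - t / l)
    convert! h2 using 1
    funext n
    rcases eq_or_ne n 0 with rfl | hn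
    · simp [Real.zero_rpow hσ]
    · rw [re_exp_mul_term c hn]
      ring

open Filter Topology in
lemma tendsto_integral_fejer_transform {H : ℂ → ℂ} (hH : ContinuousOn H {s | 1 ≤ s.re}) (l y : ℝ) :
    Tendsto (fun σ : ℝ ↦ ∫ t in (0 : ℝ)..l,
        (1 - t / l) * (Complex.exp (t * y * Complex.I) * H (σ + t * Complex.I)).re)
      (𝓝[>] 1) (𝓝 (∫ t in (0 : ℝ)..l,
        (1 - t / l) * (Complex.exp (t * y * Complex.I) * H (1 + t * Complex.I)).re)) := by
  -- Clamping `σ` at `1` extends the integrand continuously to the whole plane, so that global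
  -- parametric continuity applies.
  have hcont : Continuous fun p : ℝ × ℝ ↦ H (((max p.1 1 : ℝ) : ℂ) + p.2 * Complex.I) := by
    refine hH.comp_continuous (by fun_prop) fun p ↦ ?_
    simp
  have h := intervalIntegral.continuous_parametric_intervalIntegral_of_continuous'
    (f := fun σ t : ℝ ↦ (1 - t / l) * (Complex.exp (t * y * Complex.I) *
      H (((max σ 1 : ℝ) : ℂ) + t * Complex.I)).re) (μ := MeasureTheory.volume)
    (by
      unfold Function.uncurry
      dsimp only
      refine Continuous.mul (by fun_prop) (Complex.continuous_re.comp (Continuous.mul (by fun_prop) hcont)))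
    0 l
  have h1 := (h.tendsto 1).mono_left (nhdsWithin_le_nhds (s := Set.Ioi 1))
  simp only [max_self, Complex.ofReal_one] at h1
  refine h1.congr' ?_
  filter_upwards [self_mem_nhdsWithin] with σ hσ
  rw [max_eq_left (le_of_lt hσ)]

open Filter Topology in
lemma tendsto_integral_fejer_transform_atTop {H : ℂ → ℂ} (hH : ContinuousOn H {s | 1 ≤ s.re})
    {l : ℝ} (hl : 0 < l) :
    Tendsto (fun y : ℝ ↦ ∫ t in (0 : ℝ)..l,
        (1 - t / l) * (Complex.exp (t * y * Complex.I) * H (1 + t * Complex.I)).re)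
      atTop (𝓝 0) := by
  have hcont : Continuous fun t : ℝ ↦ H (1 + t * Complex.I) :=
    hH.comp_continuous (by fun_prop) fun p ↦ by simp
  have h := tendsto_integral_exp_mul_atTop l
    (fun t ↦ ((1 - t / l : ℝ) : ℂ) * H (1 + t * Complex.I)) hl.le
  have h2 := (Complex.continuous_re.tendsto 0).comp h
  rw [Complex.zero_re] at h2
  refine h2.congr fun y ↦ ?_
  have hint : IntervalIntegrable (fun t : ℝ ↦ Complex.exp (t * y * Complex.I) *
      (((1 - t / l : ℝ) : ℂ) * H (1 + t * Complex.I))) MeasureTheory.volume 0 l :=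
    Continuous.intervalIntegrable (Continuous.mul (by fun_prop)
      ((Complex.continuous_ofReal.comp' (by fun_prop)).mul hcont)) _ _
  rw [Function.comp_apply, ← Complex.reCLM_apply,
    ← ContinuousLinearMap.intervalIntegral_comp_comm _ hint]
  refine intervalIntegral.integral_congr fun t _ ↦ ?_
  simp only [Complex.reCLM_apply]
  rw [mul_left_comm, Complex.re_ofReal_mul]

/-! ### The Tauberian theorem for multiplicative windows. -/

lemma summable_one_div_one_add_int_sq : Summable fun j : ℤ ↦ 1 / (1 + (j : ℝ) ^ 2) := by
  refine Summable.of_norm_bounded_eventually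
    (Real.summable_one_div_int_pow.2 (by norm_num : 1 < 2)) ?_
  rw [Filter.eventually_cofinite]
  refine (Set.finite_singleton (0 : ℤ)).subset fun j hj ↦ ?_
  by_contra h0
  refine hj ?_
  have : (j : ℝ) ≠ 0 := mod_cast h0
  rw [Real.norm_of_nonneg (by positivity)]
  gcongr
  linarith

/-- A sum of `a n / n` against a kernel that decays quadratically in `log n` is bounded, uniformly
in the centre, if `a` satisfies a Chebyshev bound. -/
lemma exists_sum_div_mul_le {a : ℕ → ℝ} (ha : ∀ n, 0 ≤ a n) {C : ℝ} (hC0 : 0 ≤ C)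
    (hC : ∀ x : ℝ, 0 ≤ x → ∑ n ∈ Finset.Ioc 0 ⌊x⌋₊, a n ≤ C * x) :
    ∃ B : ℝ, 0 ≤ B ∧ ∀ (m : ℤ) (s : Finset ℕ), (∀ n ∈ s, n ≠ 0) →
      ∑ n ∈ s, a n / n * (1 / (1 + ((⌊Real.log n⌋ - m : ℤ) : ℝ) ^ 2)) ≤ B := by
  set g : ℤ → ℝ := fun j ↦ 1 / (1 + (j : ℝ) ^ 2) with hg
  have hg0 : ∀ j, 0 ≤ g j := fun j ↦ by simp only [hg]; positivity
  refine ⟨C * Real.exp 1 * ∑' j, g j, mul_nonneg (by positivity) (tsum_nonneg hg0), fun m s hs ↦ ?_⟩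
  -- Group by `⌊log n⌋`: Chebyshev bounds each block by `C * e`, and the kernel is summable over
  -- blocks.
  rw [← Finset.sum_fiberwise_of_maps_to (t := s.image fun n : ℕ ↦ ⌊Real.log n⌋)
    (g := fun n : ℕ ↦ ⌊Real.log n⌋) fun n hn ↦ Finset.mem_image_of_mem _ hn]
  have hblock : ∀ j : ℤ, ∑ n ∈ s with ⌊Real.log (n : ℕ)⌋ = j, a n / n ≤ C * Real.exp 1 := by
    intro j
    calc ∑ n ∈ s with ⌊Real.log (n : ℕ)⌋ = j, a n / n
        ≤ ∑ n ∈ s with ⌊Real.log (n : ℕ)⌋ = j, a n * Real.exp (-j) := by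
          refine Finset.sum_le_sum fun n hn ↦ ?_
          obtain ⟨hns, rfl⟩ := Finset.mem_filter.1 hn
          have hpos : (0 : ℝ) < n := by have := hs n hns; positivity
          rw [div_eq_mul_inv, Real.exp_neg]
          refine mul_le_mul_of_nonneg_left ?_ (ha n)
          gcongr
          rw [← Real.le_log_iff_exp_le hpos]
          exact Int.floor_le _
      _ ≤ ∑ n ∈ Finset.Ioc 0 ⌊Real.exp (j + 1)⌋₊, a n * Real.exp (-j) := by
          refine Finset.sum_le_sum_of_subset_of_nonneg (fun n hn ↦ ?_)
            fun n _ _ ↦ mul_nonneg (ha n) (Real.exp_pos _).le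
          obtain ⟨hns, rfl⟩ := Finset.mem_filter.1 hn
          have hpos : (0 : ℝ) < n := by have := hs n hns; positivity
          rw [Finset.mem_Ioc, Nat.le_floor_iff (Real.exp_pos _).le]
          refine ⟨Nat.pos_of_ne_zero (hs n hns), ?_⟩
          rw [← Real.log_le_iff_le_exp hpos]
          exact (Int.lt_floor_add_one _).le
      _ ≤ C * Real.exp (j + 1) * Real.exp (-j) := by
          rw [← Finset.sum_mul]
          exact mul_le_mul_of_nonneg_right (hC _ (Real.exp_pos _).le) (Real.exp_pos _).le
      _ = C * Real.exp 1 := by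
          rw [mul_assoc, ← Real.exp_add]
          congr 2
          ring
  calc _ ≤ ∑ j ∈ s.image fun n : ℕ ↦ ⌊Real.log n⌋, C * Real.exp 1 * g (j - m) := by
        refine Finset.sum_le_sum fun j _ ↦ ?_
        have : ∀ n ∈ s.filter (fun n : ℕ ↦ ⌊Real.log n⌋ = j),
            a n / n * (1 / (1 + ((⌊Real.log n⌋ - m : ℤ) : ℝ) ^ 2)) = a n / n * g (j - m) := by
          intro n hn
          rw [(Finset.mem_filter.1 hn).2]
        rw [Finset.sum_congr rfl this, ← Finset.sum_mul]
        exact mul_le_mul_of_nonneg_right (hblock j) (hg0 _)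
    _ ≤ C * Real.exp 1 * ∑' j, g j := by
        rw [← Finset.mul_sum, ← (Equiv.subRight m).tsum_eq g]
        refine mul_le_mul_of_nonneg_left ?_ (by positivity)
        exact Summable.sum_le_tsum _ (fun _ _ ↦ hg0 _)
          ((Equiv.subRight m).summable_iff.2 summable_one_div_one_add_int_sq)

/-- The weight `1 / u ^ 2` is dominated by the discretized kernel away from `u = 0`. -/
lemma one_div_sq_le_discrete {z y ε : ℝ} (hε : 0 < ε) (h : ε ≤ |z - y|) :
    1 / (z - y) ^ 2 ≤ (3 / ε ^ 2 + 2) * (1 / (1 + ((⌊z⌋ - ⌊y⌋ : ℤ) : ℝ) ^ 2)) := by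
  have h1 : ε ^ 2 ≤ (z - y) ^ 2 := by
    rw [← sq_abs (z - y)]
    gcongr
  have h2 : 1 ≤ (z - y) ^ 2 / ε ^ 2 := (one_le_div (by positivity)).2 h1
  have h3 : |((⌊z⌋ - ⌊y⌋ : ℤ) : ℝ)| ≤ |z - y| + 1 := by
    push_cast
    have := Int.floor_le z
    have := Int.lt_floor_add_one z
    have := Int.floor_le y
    have := Int.lt_floor_add_one y
    rw [abs_le]
    constructor <;> [linarith [neg_abs_le (z - y)]; linarith [le_abs_self (z - y)]]
  -- With `u = z - y` this gives `1 + (⌊z⌋ - ⌊y⌋)^2 ≤ 3 + 2 u^2`, and `3 ≤ (3 / ε^2) u^2`.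
  have h4 : ((⌊z⌋ - ⌊y⌋ : ℤ) : ℝ) ^ 2 ≤ 2 * (z - y) ^ 2 + 2 := by
    rw [← sq_abs, ← sq_abs (z - y)]
    nlinarith [abs_nonneg ((⌊z⌋ - ⌊y⌋ : ℤ) : ℝ), sq_nonneg (|z - y| - 1)]
  have hpos : 0 < (z - y) ^ 2 := lt_of_lt_of_le (by positivity) h1
  rw [mul_one_div, div_le_div_iff₀ hpos (by positivity)]
  have : 3 / ε ^ 2 * (z - y) ^ 2 = 3 * ((z - y) ^ 2 / ε ^ 2) := by ring
  rw [add_mul, this]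
  linarith

/-- The integral is the weighted sum of `a n` minus `A` times that of `1`. By positivity the latter
may be cut down to any finite `M`; the former is split into the near part `N` and a remainder
bounded by `F`. -/
lemma sum_fejer_le_of_one_lt {a : ℕ → ℝ} (ha : ∀ n, 0 ≤ a n) {A : ℝ} (hA : 0 ≤ A) {H : ℂ → ℂ}
    (hsum : ∀ σ : ℝ, 1 < σ → Summable fun n ↦ a n / (n : ℝ) ^ σ)
    (hHs : ∀ s : ℂ, 1 < s.re →
      HasSum (LSeries.term (fun n ↦ ((a n - A : ℝ) : ℂ)) s) (H s))
    {l F y σ : ℝ} (hl : 0 < l) (hσ : 1 < σ) (N M : Finset ℕ)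
    (hF : ∀ s : Finset ℕ, (∀ n ∈ s, n ≠ 0 ∧ n ∉ N) →
      ∑ n ∈ s, a n / n * fejer l (Real.log n - y) ≤ F) :
    (∫ t in (0 : ℝ)..l,
        (1 - t / l) * (Complex.exp (t * y * Complex.I) * H (σ + t * Complex.I)).re) +
      A * ∑ n ∈ M, 1 / (n : ℝ) ^ σ * fejer l (Real.log n - y) ≤
      ∑ n ∈ N, a n / (n : ℝ) ^ σ * fejer l (Real.log n - y) + F := by
  have hσ0 : σ ≠ 0 := by positivity
  have h1 : Summable fun n : ℕ ↦ 1 / (n : ℝ) ^ σ := Real.summable_one_div_nat_rpow.2 hσ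
  have hw : ∀ {v : ℕ → ℝ}, (∀ n, 0 ≤ v n) → Summable v →
      Summable fun n : ℕ ↦ v n * fejer l (Real.log n - y) := fun {v} hv hs ↦
    Summable.of_nonneg_of_le (fun n ↦ mul_nonneg (hv n) (fejer_nonneg hl _))
      (fun n ↦ mul_le_mul_of_nonneg_left (fejer_le hl _) (hv n)) (hs.mul_right l)
  have h0 : ∀ n, 0 ≤ a n / (n : ℝ) ^ σ := fun n ↦ div_nonneg (ha n) (by positivity)
  have ha' := hw h0 (hsum σ hσ)
  have h1' := hw (fun n ↦ by positivity) h1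
  have hc : Summable fun n ↦ |a n - A| / (n : ℝ) ^ σ := by
    refine Summable.of_nonneg_of_le (fun n ↦ by positivity) (fun n ↦ ?_)
      ((hsum σ hσ).add (h1.mul_left A))
    rw [mul_one_div, ← add_div]
    gcongr
    rw [abs_le]
    constructor <;> linarith [ha n]
  have key := hasSum_mul_fejer hσ0 hl y (fun t ↦ hHs (σ + t * Complex.I) (by simpa using hσ)) hc
  have key2 := ha'.hasSum.sub (h1'.hasSum.mul_left A)
  have heq := key.unique (by
    convert! key2 using 1
    funext n
    ring)
  rw [heq]
  have hM : ∑ n ∈ M, 1 / (n : ℝ) ^ σ * fejer l (Real.log n - y) ≤ _ :=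
    h1'.sum_le_tsum M fun n _ ↦ mul_nonneg (by positivity) (fejer_nonneg hl _)
  have hN : ∑' n : ℕ, a n / (n : ℝ) ^ σ * fejer l (Real.log n - y) ≤
      ∑ n ∈ N, a n / (n : ℝ) ^ σ * fejer l (Real.log n - y) + F := by
    refine ha'.tsum_le_of_sum_le fun s ↦ ?_
    rw [← Finset.sum_filter_add_sum_filter_not s (· ∈ N)]
    refine add_le_add (Finset.sum_le_sum_of_subset_of_nonneg
      (fun n hn ↦ (Finset.mem_filter.1 hn).2) fun n _ _ ↦ mul_nonneg (h0 n) (fejer_nonneg hl _)) ?_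
    -- The term at `0` vanishes because `0 ^ σ = 0`; elsewhere `n ≤ n ^ σ` reduces to the bound `F`,
    -- which is independent of `σ`.
    rw [← Finset.sum_filter_of_ne (p := fun n ↦ n ≠ 0)]
    · refine le_trans (Finset.sum_le_sum fun n hn ↦ ?_)
        (hF _ fun n hn ↦ ⟨(Finset.mem_filter.1 hn).2,
          (Finset.mem_filter.1 (Finset.mem_filter.1 hn).1).2⟩)
      have hn0 : n ≠ 0 := (Finset.mem_filter.1 hn).2
      have hn1 : (1 : ℝ) ≤ n := mod_cast Nat.one_le_iff_ne_zero.2 hn0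
      refine mul_le_mul_of_nonneg_right ?_ (fejer_nonneg hl _)
      refine div_le_div_of_nonneg_left (ha n) (by positivity) ?_
      exact Real.self_le_rpow_of_one_le hn1 hσ.le
    · rintro n _ hn rfl
      simp [Real.zero_rpow hσ0] at hn
  have := mul_le_mul_of_nonneg_left hM hA
  linarith

open Filter Topology in
lemma sum_fejer_le {a : ℕ → ℝ} (ha : ∀ n, 0 ≤ a n) {A : ℝ} (hA : 0 ≤ A) {H : ℂ → ℂ}
    (hH : ContinuousOn H {s | 1 ≤ s.re})
    (hsum : ∀ σ : ℝ, 1 < σ → Summable fun n ↦ a n / (n : ℝ) ^ σ)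
    (hHs : ∀ s : ℂ, 1 < s.re →
      HasSum (LSeries.term (fun n ↦ ((a n - A : ℝ) : ℂ)) s) (H s))
    {l F y : ℝ} (hl : 0 < l) (N M : Finset ℕ) (hN : ∀ n ∈ N, n ≠ 0) (hM : ∀ n ∈ M, n ≠ 0)
    (hF : ∀ s : Finset ℕ, (∀ n ∈ s, n ≠ 0 ∧ n ∉ N) →
      ∑ n ∈ s, a n / n * fejer l (Real.log n - y) ≤ F) :
    (∫ t in (0 : ℝ)..l,
        (1 - t / l) * (Complex.exp (t * y * Complex.I) * H (1 + t * Complex.I)).re) +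
      A * ∑ n ∈ M, 1 / (n : ℝ) * fejer l (Real.log n - y) ≤
      ∑ n ∈ N, a n / (n : ℝ) * fejer l (Real.log n - y) + F := by
  have hlim : ∀ (v : ℕ → ℝ) (S : Finset ℕ), (∀ n ∈ S, n ≠ 0) →
      Tendsto (fun σ : ℝ ↦ ∑ n ∈ S, v n / (n : ℝ) ^ σ * fejer l (Real.log n - y)) (𝓝[>] 1)
        (𝓝 (∑ n ∈ S, v n / (n : ℝ) * fejer l (Real.log n - y))) := by
    intro v S hS
    refine tendsto_finsetSum _ fun n hn ↦ Tendsto.mul_const _ ?_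
    have hpos : (0 : ℝ) < n := by have := hS n hn; positivity
    have h1 : Tendsto (fun σ : ℝ ↦ (n : ℝ) ^ σ) (𝓝[>] 1) (𝓝 ((n : ℝ) ^ (1 : ℝ))) :=
      ((Real.continuous_const_rpow hpos.ne').tendsto 1).mono_left nhdsWithin_le_nhds
    rw [Real.rpow_one] at h1
    exact tendsto_const_nhds.div h1 hpos.ne'
  refine le_of_tendsto_of_tendsto
    ((tendsto_integral_fejer_transform hH l y).add ((hlim (fun _ ↦ 1) M hM).const_mul A))
    ((hlim a N hN).add_const F) ?_
  filter_upwards [self_mem_nhdsWithin] with σ hσ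
  exact sum_fejer_le_of_one_lt ha hA hsum hHs hl hσ N M hF

/-- There are at least `X / (2l)` integers in the range, each with `1 / n ≥ 1 / (3X)` and kernel at
least `l / 8`. The bound does not depend on `l`, whereas the far contribution decays like `1 / l`.
-/
lemma le_sum_one_div_mul_fejer {l X : ℝ} (hl : 1 ≤ l) (hX : 2 * l ≤ X) :
    1 / 48 ≤ ∑ n ∈ Finset.Ioc ⌊X⌋₊ ⌊X * Real.exp (1 / l)⌋₊,
      1 / (n : ℝ) * fejer l (Real.log n - Real.log X) := by
  have hl0 : 0 < l := by linarith
  have hX0 : 0 < X := by linarith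
  have he3 : Real.exp (1 / l) ≤ 3 :=
    (Real.exp_le_exp.2 ((div_le_one hl0).2 hl)).trans (by linarith [Real.exp_one_lt_d9])
  have he1 : 1 / l + 1 ≤ Real.exp (1 / l) := Real.add_one_le_exp _
  have hterm : ∀ n ∈ Finset.Ioc ⌊X⌋₊ ⌊X * Real.exp (1 / l)⌋₊,
      1 / (3 * X) * (l / 8) ≤ 1 / (n : ℝ) * fejer l (Real.log n - Real.log X) := by
    intro n hn
    rw [Finset.mem_Ioc, Nat.floor_lt hX0.le, Nat.le_floor_iff (by positivity)] at hn
    have hn0 : (0 : ℝ) < n := hX0.trans hn.1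
    have h1 : Real.log X < Real.log n := Real.log_lt_log hX0 hn.1
    have h2 : Real.log n ≤ Real.log X + 1 / l := by
      rw [← Real.log_exp (1 / l), ← Real.log_mul hX0.ne' (Real.exp_pos _).ne']
      exact Real.log_le_log hn0 hn.2
    refine mul_le_mul ?_ (le_fejer hl0 (by linarith) ?_) (by positivity) (by positivity)
    · gcongr
      nlinarith [hn.2]
    · rw [abs_of_nonneg (mul_nonneg hl0.le (by linarith))]
      calc l * (Real.log n - Real.log X) ≤ l * (1 / l) := by gcongr; linarith
        _ = 1 := by field_simp
  refine le_trans ?_ (Finset.card_nsmul_le_sum _ _ _ hterm)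
  rw [Nat.card_Ioc, nsmul_eq_mul]
  have hcard : X / (2 * l) ≤ ((⌊X * Real.exp (1 / l)⌋₊ - ⌊X⌋₊ : ℕ) : ℝ) := by
    have h1 := Nat.sub_one_lt_floor (X * Real.exp (1 / l))
    have h2 := Nat.floor_le hX0.le
    have h3 : (⌊X * Real.exp (1 / l)⌋₊ : ℝ) ≤
        ((⌊X * Real.exp (1 / l)⌋₊ - ⌊X⌋₊ : ℕ) : ℝ) + ⌊X⌋₊ := by
      exact_mod_cast le_tsub_add
    have h4 : X * (1 / l + 1) ≤ X * Real.exp (1 / l) := by gcongr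
    have h5 : 1 ≤ X / (2 * l) := (one_le_div (by positivity)).2 hX
    have h6 : X * (1 / l + 1) = 2 * (X / (2 * l)) + X := by field_simp
    linarith
  calc (1 / 48 : ℝ) = X / (2 * l) * (1 / (3 * X) * (l / 8)) := by field_simp; norm_num
    _ ≤ _ := by gcongr

open Filter Topology in
/-- **A Tauberian theorem of Wiener–Ikehara type for short multiplicative windows.** -/
theorem exists_eventually_le_sum_window {a : ℕ → ℝ} (ha : ∀ n, 0 ≤ a n) {A C : ℝ} (hA : 0 < A)
    (hC0 : 0 ≤ C) (hC : ∀ x : ℝ, 0 ≤ x → ∑ n ∈ Finset.Ioc 0 ⌊x⌋₊, a n ≤ C * x) {H : ℂ → ℂ}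
    (hH : ContinuousOn H {s | 1 ≤ s.re})
    (hsum : ∀ σ : ℝ, 1 < σ → Summable fun n ↦ a n / (n : ℝ) ^ σ)
    (hHs : ∀ s : ℂ, 1 < s.re →
      HasSum (LSeries.term (fun n ↦ ((a n - A : ℝ) : ℂ)) s) (H s)) {ε : ℝ} (hε : 0 < ε) :
    ∃ δ > 0, ∀ᶠ X : ℝ in atTop,
      δ ≤ ∑ n ∈ Finset.Ioc 0 ⌊X * Real.exp ε⌋₊ with X * Real.exp (-ε) ≤ (n : ℕ), a n / n := by
  obtain ⟨B, hB0, hB⟩ := exists_sum_div_mul_le ha hC0 hC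
  set D : ℝ := (3 / ε ^ 2 + 2) * B with hD
  have hD0 : 0 ≤ D := by positivity
  -- Chosen so that the far part is at most `A / 192`. With an error of at most `A / 192` from the
  -- integral, the main term `A / 48` leaves `A / 96`; dividing by the kernel's maximum `l` gives
  -- `δ`.
  set l : ℝ := 1 + 384 * D / A with hl
  have hl1 : 1 ≤ l := by
    have : 0 ≤ 384 * D / A := by positivity
    linarith
  have hl0 : 0 < l := by linarith
  have hFA : 2 / l * D ≤ A / 192 := by
    rw [div_mul_eq_mul_div, div_le_div_iff₀ hl0 (by norm_num)]
    have : A * l = A + 384 * D := by rw [hl]; field_simp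
    linarith
  refine ⟨A / (96 * l), by positivity, ?_⟩
  have hR := ((tendsto_integral_fejer_transform_atTop hH hl0).comp
    Real.tendsto_log_atTop).eventually_const_lt (by linarith : -(A / 192) < 0)
  filter_upwards [hR, eventually_ge_atTop (2 * l)] with X hRX hX
  have hX0 : 0 < X := by linarith
  set N := (Finset.Ioc 0 ⌊X * Real.exp ε⌋₊).filter fun n : ℕ ↦ X * Real.exp (-ε) ≤ (n : ℝ) with hN
  have hF : ∀ s : Finset ℕ, (∀ n ∈ s, n ≠ 0 ∧ n ∉ N) →
      ∑ n ∈ s, a n / n * fejer l (Real.log n - Real.log X) ≤ 2 / l * D := by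
    intro s hs
    calc ∑ n ∈ s, a n / n * fejer l (Real.log n - Real.log X)
        ≤ ∑ n ∈ s, 2 / l * (3 / ε ^ 2 + 2) * (a n / n *
          (1 / (1 + ((⌊Real.log n⌋ - ⌊Real.log X⌋ : ℤ) : ℝ) ^ 2))) := by
          refine Finset.sum_le_sum fun n hn ↦ ?_
          obtain ⟨hn0, hnN⟩ := hs n hn
          have hpos : (0 : ℝ) < n := by positivity
          have hfar : ε ≤ |Real.log n - Real.log X| := by
            by_contra! hlt
            rw [abs_lt] at hlt
            refine hnN (Finset.mem_filter.2 ⟨Finset.mem_Ioc.2 ⟨Nat.pos_of_ne_zero hn0,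
              (Nat.le_floor_iff (by positivity)).2 ?_⟩, ?_⟩)
            · rw [← Real.log_le_log_iff hpos (by positivity),
                Real.log_mul hX0.ne' (Real.exp_pos _).ne', Real.log_exp]
              linarith
            · rw [← Real.log_le_log_iff (by positivity) hpos,
                Real.log_mul hX0.ne' (Real.exp_pos _).ne', Real.log_exp]
              linarith
          have hne : Real.log n - Real.log X ≠ 0 := by
            intro h0
            rw [h0, abs_zero] at hfar
            linarith
          calc a n / n * fejer l (Real.log n - Real.log X)
              ≤ a n / n * (2 / l * ((3 / ε ^ 2 + 2) *
                (1 / (1 + ((⌊Real.log n⌋ - ⌊Real.log X⌋ : ℤ) : ℝ) ^ 2)))) := by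
                refine mul_le_mul_of_nonneg_left ((fejer_le_of_ne hl0 hne).trans ?_)
                  (div_nonneg (ha n) hpos.le)
                rw [← div_div, div_eq_mul_one_div (2 / l)]
                exact mul_le_mul_of_nonneg_left (one_div_sq_le_discrete hε hfar) (by positivity)
            _ = _ := by ring
      _ ≤ 2 / l * D := by
          rw [← Finset.mul_sum, hD, mul_assoc]
          refine mul_le_mul_of_nonneg_left (mul_le_mul_of_nonneg_left ?_ (by positivity))
            (by positivity)
          exact hB _ s fun n hn ↦ (hs n hn).1
  have key := sum_fejer_le ha hA.le hH hsum hHs hl0 N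
    (Finset.Ioc ⌊X⌋₊ ⌊X * Real.exp (1 / l)⌋₊)
    (fun n hn ↦ (Finset.mem_Ioc.1 (Finset.mem_filter.1 hn).1).1.ne')
    (fun n hn ↦ ((Nat.zero_le _).trans_lt (Finset.mem_Ioc.1 hn).1).ne') hF
  have hmain := mul_le_mul_of_nonneg_left (le_sum_one_div_mul_fejer hl1 hX) hA.le
  have hup : ∑ n ∈ N, a n / n * fejer l (Real.log n - Real.log X) ≤ (∑ n ∈ N, a n / n) * l := by
    rw [Finset.sum_mul]
    exact Finset.sum_le_sum fun n _ ↦ mul_le_mul_of_nonneg_left (fejer_le hl0 _)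
      (div_nonneg (ha n) n.cast_nonneg)
  simp only [Function.comp_apply] at hRX
  rw [← div_div, div_le_iff₀ hl0]
  linarith

/-! ### Primes of a residue class in multiplicative windows. -/

/-- `LFunctionResidueClassAux` has `A / (s - 1)` removed, while the Tauberian theorem wants `A * ζ`
removed; this function, extended over `s = 1`, is the correction. -/
lemma continuous_update_riemannZeta_sub :
    Continuous (Function.update (fun s : ℂ ↦ riemannZeta s - 1 / (s - 1)) 1
      (Real.eulerMascheroniConstant : ℂ)) := by
  rw [continuous_iff_continuousAt]
  intro s
  rcases eq_or_ne s 1 with rfl | hs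
  · exact continuousAt_update_same.2 tendsto_riemannZeta_sub_one_div
  · rw [continuousAt_update_of_ne hs]
    exact (differentiableAt_riemannZeta hs).continuousAt.sub
      (continuousAt_const.div (by fun_prop) (sub_ne_zero.2 hs))

open ArithmeticFunction vonMangoldt Filter in
/-- Every window `[X e ^ (-ε), X e ^ ε]` contains a prime in a given invertible residue class, for
`X` large. -/
theorem eventually_exists_prime_mem_window {q : ℕ} [NeZero q] {c : ZMod q} (hc : IsUnit c) {ε : ℝ}
    (hε : 0 < ε) :
    ∀ᶠ X : ℝ in atTop, ∃ p : ℕ, p.Prime ∧ (p : ZMod q) = c ∧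
      X * Real.exp (-ε) ≤ p ∧ p ≤ X * Real.exp ε := by
  have hA : (0 : ℝ) < (q.totient : ℝ)⁻¹ := inv_pos.2 (mod_cast Nat.totient_pos.2 q.pos_of_neZero)
  have hab := abscissaOfAbsConv_residueClass_le_one c
  obtain ⟨δ, hδ, hev⟩ := exists_eventually_le_sum_window (a := residueClass c)
    (H := fun s ↦ LFunctionResidueClassAux c s - ((q.totient : ℝ)⁻¹ : ℝ) *
      Function.update (fun s : ℂ ↦ riemannZeta s - 1 / (s - 1)) 1
        (Real.eulerMascheroniConstant : ℂ) s)
    (residueClass_nonneg c) hA (by positivity : 0 ≤ Real.log 4 + 4)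
    (fun x hx ↦ (Finset.sum_le_sum fun n _ ↦ residueClass_le c n).trans
      (Chebyshev.psi_le_const_mul_self hx))
    ((continuousOn_LFunctionResidueClassAux c).sub
      (continuous_const.mul continuous_update_riemannZeta_sub).continuousOn)
    (fun σ hσ ↦ LSeries.summable_real_of_abscissaOfAbsConv_lt (hab.trans_lt (mod_cast hσ)))
    (fun s hs ↦ by
      have h1 : LSeriesHasSum (fun n ↦ (residueClass c n : ℂ)) s
          (LSeries (fun n ↦ (residueClass c n : ℂ)) s) :=
        (LSeriesSummable_of_abscissaOfAbsConv_lt_re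
          (hab.trans_lt (mod_cast hs))).LSeriesHasSum
      have h2 := (LSeriesHasSum_one hs).smul (((q.totient : ℝ)⁻¹ : ℝ) : ℂ)
      have hs1 : s ≠ 1 := by rintro rfl; simp at hs
      have h3 := h1.sub h2
      rw [LSeriesHasSum] at h3
      convert! h3 using 1
      · congr 1
        funext n
        simp
      · rw [eqOn_LFunctionResidueClassAux hc hs, Function.update_of_ne hs1]
        push_cast
        ring) hε
  -- Non-primes have a convergent total, so beyond the finite set `s` they cannot supply the weight
  -- `δ` of a window.
  obtain ⟨s, hs⟩ := summable_iff_vanishing_norm.1 (summable_residueClass_non_primes_div c) δ hδ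
  filter_upwards [hev, eventually_gt_atTop ((s.sup id : ℕ) * Real.exp ε)] with X hX hXs
  by_contra! hno
  have hX0 : 0 ≤ X := le_trans (by positivity) hXs.le
  set N := (Finset.Ioc 0 ⌊X * Real.exp ε⌋₊).filter fun n : ℕ ↦ X * Real.exp (-ε) ≤ (n : ℝ) with hN
  have hdisj : Disjoint N s := by
    rw [Finset.disjoint_left]
    intro n hn hns
    have h1 : (n : ℝ) ≤ (s.sup id : ℕ) := mod_cast Finset.le_sup (f := id) hns
    have h2 := (Finset.mem_filter.1 hn).2
    have h3 : ((s.sup id : ℕ) : ℝ) < X * Real.exp (-ε) := by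
      rwa [Real.exp_neg, ← div_eq_mul_inv, lt_div_iff₀ (Real.exp_pos _)]
    linarith
  have h1 := hs N hdisj
  refine absurd hX (not_le.2 ?_)
  refine lt_of_le_of_lt (le_of_eq ?_) ((le_abs_self _).trans_lt h1)
  refine Finset.sum_congr rfl fun n hn ↦ ?_
  split_ifs with hp
  · obtain ⟨hn1, hn2⟩ := Finset.mem_filter.1 hn
    have hn3 := (Nat.le_floor_iff (by positivity)).1 (Finset.mem_Ioc.1 hn1).2
    have : (n : ZMod q) ≠ c := fun h ↦ absurd hn3 (not_le.2 (hno n hp h hn2))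
    simp [residueClass, this]
  · rfl

/-! ### Residue classes where all discriminants are nonresidues. -/

lemma jacobiSym_congr_right {D : ℤ} {m n : ℕ} (hm : Odd m) (hn : Odd n)
    (h : m ≡ n [MOD 4 * D.natAbs]) : jacobiSym D m = jacobiSym D n := by
  rw [jacobiSym.mod_right D hm, jacobiSym.mod_right D hn, h]

/-- If an odd prime divides `u` exactly once, then `u` is a nonresidue modulo suitable primes that
are `1` modulo `a`. -/
lemma exists_prime_jacobiSym_mul_eq_neg_one {r m a : ℕ} (hr : r.Prime) (hr2 : r ≠ 2)
    (hrm : ¬ r ∣ m) (hra : ¬ r ∣ a) (ha : a ≠ 0) (hm : m ≠ 0) {e : ℤ} (he : e.natAbs = m) (B : ℕ) :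
    ∃ p, p.Prime ∧ B < p ∧ p ≡ 1 [MOD a] ∧ jacobiSym (e * r) p = -1 := by
  have : Fact r.Prime := ⟨hr⟩
  obtain ⟨ν, hν⟩ := FiniteField.exists_nonsquare (F := ZMod r) (by rwa [ZMod.ringChar_zmod_n])
  have hν0 : ν ≠ 0 := by rintro rfl; exact hν (IsSquare.zero)
  have hro : Odd r := hr.odd_of_ne_two hr2
  have hcop : (8 * a * m).Coprime r := by
    rw [Nat.coprime_comm, hr.coprime_iff_not_dvd, hr.dvd_mul, hr.dvd_mul]
    rintro ((h | h) | h)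
    · exact hr2 ((Nat.prime_dvd_prime_iff_eq hr Nat.prime_two).1
        (hr.dvd_of_dvd_pow (by simpa using h : r ∣ 2 ^ 3)))
    · exact hra h
    · exact hrm h
  obtain ⟨k, hk1, hk2⟩ := Nat.chineseRemainder hcop 1 ν.val
  have hkcop : k.Coprime (8 * a * m * r) := by
    refine Nat.Coprime.mul_right ?_ ?_
    · rw [Nat.Coprime, hk1.gcd_eq]
      simp
    · rw [Nat.Coprime, hk2.gcd_eq]
      rw [← Nat.Coprime, Nat.coprime_comm, hr.coprime_iff_not_dvd]
      intro h
      have := (ZMod.natCast_eq_zero_iff _ _).2 h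
      rw [ZMod.natCast_zmod_val] at this
      exact hν0 this
  obtain ⟨p, hpB, hp, hpk⟩ := Nat.forall_exists_prime_gt_and_modEq (max B 2)
    (by have := hr.ne_zero; positivity) hkcop
  have hp1 : p ≡ 1 [MOD 8 * a * m] := (hpk.of_mul_right r).trans hk1
  have hpr : p ≡ ν.val [MOD r] := (hpk.of_mul_left _).trans hk2
  have hpo : Odd p := hp.odd_of_ne_two (by omega)
  have hp4 : p ≡ 1 [MOD 4] := hp1.of_dvd ⟨2 * a * m, by ring⟩
  refine ⟨p, hp, by omega, hp1.of_dvd ⟨8 * m, by ring⟩, ?_⟩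
  have h1 : jacobiSym e p = 1 := by
    rw [jacobiSym_congr_right hpo odd_one (hp1.of_dvd ⟨2 * a, by rw [he]; ring⟩),
      jacobiSym.one_right]
  -- As `p ≡ 1 (mod 4)`, reciprocity carries no sign: `(r/p) = (p/r) = (ν/r) = -1`.
  rw [jacobiSym.mul_left, h1, one_mul, ← jacobiSym.quadratic_reciprocity_one_mod_four hp4 hro,
    ZMod.nonsquare_iff_jacobiSym_eq_neg_one]
  rwa [Int.cast_natCast, (ZMod.natCast_eq_natCast_iff _ _ _).2 hpr, ZMod.natCast_zmod_val]

/-- A prime in a given class modulo `8` that is `1` modulo an odd number. -/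
lemma exists_prime_modEq_eight {a : ℕ} (hao : Odd a) {k : ℕ} (hk : Odd k) (B : ℕ) :
    ∃ p, p.Prime ∧ B < p ∧ p ≡ 1 [MOD a] ∧ p ≡ k [MOD 8] := by
  have hcop : a.Coprime 8 := (Nat.coprime_two_right.2 hao).pow_right 3
  obtain ⟨c, hc1, hc2⟩ := Nat.chineseRemainder hcop 1 k
  have hccop : c.Coprime (a * 8) := by
    refine Nat.Coprime.mul_right ?_ ?_
    · rw [Nat.Coprime, hc1.gcd_eq]
      simp
    · rw [Nat.Coprime, hc2.gcd_eq]
      exact (Nat.coprime_two_right.2 hk).pow_right 3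
  obtain ⟨p, hpB, hp, hpc⟩ := Nat.forall_exists_prime_gt_and_modEq B
    (by have := hao.pos; positivity) hccop
  exact ⟨p, hp, hpB, (hpc.of_mul_right _).trans hc1, (hpc.of_mul_left _).trans hc2⟩

/-- A nonsquare `D ≡ 0, 1 (mod 4)` is a nonresidue modulo arbitrarily large primes that are `1`
modulo a given number coprime to `D`. -/
theorem exists_prime_jacobiSym_eq_neg_one {D : ℤ} (hD : ¬ IsSquare D)
    (hD4 : D % 4 = 0 ∨ D % 4 = 1) {a : ℕ} (ha : a ≠ 0) (hcop : IsCoprime (a : ℤ) D) (B : ℕ) :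
    ∃ p, p.Prime ∧ B < p ∧ p ≡ 1 [MOD a] ∧ jacobiSym D p = -1 := by
  have hD0 : D ≠ 0 := by rintro rfl; exact hD IsSquare.zero
  obtain ⟨u, s, hus, hu⟩ := Nat.sq_mul_squarefree D.natAbs
  have hs0 : s ≠ 0 := by
    rintro rfl
    simp at hus
    exact hD0 (Int.natAbs_eq_zero.1 hus.symm)
  obtain ⟨e, he, hDe⟩ : ∃ e : ℤ, (e = 1 ∨ e = -1) ∧ D = e * u * (s : ℤ) ^ 2 := by
    have h1 : ((s : ℤ) ^ 2 * u) = (D.natAbs : ℤ) := mod_cast hus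
    rcases Int.natAbs_eq D with h | h
    · exact ⟨1, .inl rfl, by rw [h, ← h1]; ring⟩
    · exact ⟨-1, .inr rfl, by rw [h, ← h1]; ring⟩
  have hcop' : a.Coprime D.natAbs := by
    simpa [Int.isCoprime_iff_gcd_eq_one, Int.gcd] using hcop
  -- Taking `p > s` makes `s ^ 2` invisible to the symbol, leaving `±u` with `u` squarefree.
  suffices h : ∃ p, p.Prime ∧ max B s < p ∧ p ≡ 1 [MOD a] ∧ jacobiSym (e * u) p = -1 by
    obtain ⟨p, hp, hpB, hpa, hj⟩ := h
    refine ⟨p, hp, by omega, hpa, ?_⟩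
    have hsp : Int.gcd (s : ℤ) p = 1 := by
      rw [Int.gcd_natCast_natCast]
      exact (hp.coprime_iff_not_dvd.2
        (Nat.not_dvd_of_pos_of_lt (Nat.pos_of_ne_zero hs0) (by omega))).symm
    rw [hDe, jacobiSym.mul_left, hj, jacobiSym.sq_one' hsp, mul_one]
  have haodd : Even D → Odd a := fun h ↦ by
    have h2 : 2 ∣ D.natAbs := Int.natCast_dvd.1 h.two_dvd
    exact Nat.coprime_two_right.1 (hcop'.coprime_dvd_right h2)
  rcases u.eq_two_pow_or_exists_odd_prime_and_dvd with ⟨k, rfl⟩ | ⟨r, hr, ⟨m, rfl⟩, hro⟩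
  · have hk : k = 0 ∨ k = 1 := by
      by_contra! h
      have : 2 * 2 ∣ 2 ^ k := ⟨2 ^ (k - 2), by rw [← pow_two, ← pow_add]; congr 1; omega⟩
      exact absurd (hu 2 this) (by decide)
    rcases hk with rfl | rfl
    · rcases he with rfl | rfl
      · exact absurd ⟨(s : ℤ), by rw [hDe]; push_cast; ring⟩ hD
      · have hDs : D = -(s : ℤ) ^ 2 := by rw [hDe]; push_cast; ring
        -- An odd `s` would give `D ≡ 3 (mod 4)`. Evenness makes `a` odd, so `p ≡ 3 (mod 8)` is
        -- compatible with `p ≡ 1 (mod a)`.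
        have hse : Even (s : ℤ) := by
          by_contra h
          rw [Int.not_even_iff_odd] at h
          have := Int.sq_mod_four_eq_one_of_odd h
          omega
        obtain ⟨p, hp, hpB, hpa, hp8⟩ := exists_prime_modEq_eight
          (haodd (by rw [hDs]; exact ((hse.pow_of_ne_zero two_ne_zero)).neg))
          (k := 3) (by decide) (max B s)
        have hp4 : p ≡ 3 [MOD 4] := hp8.of_dvd (by norm_num)
        have hp4' : p % 4 = 3 := hp4
        refine ⟨p, hp, hpB, hpa, ?_⟩
        have : (-1 : ℤ) * ((2 ^ 0 : ℕ) : ℤ) = -1 := by norm_num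
        rw [this, jacobiSym.at_neg_one (Nat.odd_iff.2 (by omega)), ZMod.χ₄_nat_three_mod_four hp4']
    -- The class `5` modulo `8` makes both `2` and `-2` nonresidues.
    · obtain ⟨p, hp, hpB, hpa, hp8⟩ := exists_prime_modEq_eight
        (haodd (by
          rw [hDe]
          exact Even.mul_right (Even.mul_left (by norm_num) _) _))
        (k := 5) (by decide) (max B s)
      have hp5 : p % 8 = 5 := hp8
      have hpo : Odd p := Nat.odd_iff.2 (by omega)
      refine ⟨p, hp, hpB, hpa, ?_⟩
      rcases he with rfl | rfl
      · have : (1 : ℤ) * ((2 ^ 1 : ℕ) : ℤ) = 2 := by norm_num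
        rw [this, jacobiSym.at_two hpo, ZMod.χ₈_nat_mod_eight, hp5]
        decide
      · have : (-1 : ℤ) * ((2 ^ 1 : ℕ) : ℤ) = -2 := by norm_num
        rw [this, jacobiSym.at_neg_two hpo, (ZMod.natCast_eq_natCast_iff _ _ _).2 hp8]
        decide
  · have hm0 : m ≠ 0 := by
      rintro rfl
      simp at hu
    have hrm : ¬ r ∣ m := fun h ↦ hr.ne_one (Nat.isUnit_iff.1 (hu r (Nat.mul_dvd_mul_left r h)))
    have hra : ¬ r ∣ a := fun h ↦ by
      have h1 : r ∣ D.natAbs := ⟨s ^ 2 * m, by rw [← hus]; ring⟩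
      exact hr.ne_one (Nat.eq_one_of_dvd_coprimes hcop' h h1)
    have hem : (e * m).natAbs = m := by rcases he with rfl | rfl <;> simp
    obtain ⟨p, hp, hpB, hpa, hj⟩ := exists_prime_jacobiSym_mul_eq_neg_one hr
      (by rintro rfl; exact absurd hro (by decide)) hrm hra ha hm0 hem (max B s)
    refine ⟨p, hp, hpB, hpa, ?_⟩
    rw [← hj]
    congr 1
    push_cast
    ring

open Finset in
/-- If the signed count of the square subproducts is nonzero, some class modulo
`4 * a * ∏ |D i|` above a given class modulo `a` has all `D i` as nonresidues. -/
theorem exists_unit_forall_jacobiSym_eq_neg_one {I : ℕ} {D : Fin I → ℤ} (hD0 : ∀ i, D i ≠ 0)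
    (hD4 : ∀ i, D i % 4 = 0 ∨ D i % 4 = 1) (hD : squareSubsetSum D ≠ 0) {a b : ℕ} (ha : a ≠ 0)
    (hcop : IsCoprime (a : ℤ) (∏ i, D i)) (hab : b.Coprime a) :
    ∃ q, q ≠ 0 ∧ ∃ c : ZMod q, IsUnit c ∧ ∀ p : ℕ, (p : ZMod q) = c →
      p ≡ b [MOD a] ∧ ∀ i, jacobiSym (D i) p = -1 := by
  classical
  set q := 4 * a * (∏ i, D i).natAbs with hq
  have hP0 : (∏ i, D i).natAbs ≠ 0 := Int.natAbs_ne_zero.2 (prod_ne_zero_iff.2 fun i _ ↦ hD0 i)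
  have hq0 : q ≠ 0 := by positivity
  have : NeZero q := ⟨hq0⟩
  have haq : a ∣ q := ⟨4 * (∏ i, D i).natAbs, by rw [hq]; ring⟩
  have hJq : ∀ J : Finset (Fin I), 4 * (∏ j ∈ J, D j).natAbs ∣ q := fun J ↦ by
    rw [hq, mul_right_comm, mul_assoc]
    refine mul_dvd_mul_left 4 (Dvd.dvd.mul_right ?_ a)
    exact Int.natAbs_dvd_natAbs.2 (prod_dvd_prod_of_subset _ _ _ (subset_univ J))
  have hodd : ∀ n : ℕ, IsUnit (n : ZMod q) → Odd n := fun n hn ↦ by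
    have h := (ZMod.isUnit_iff_coprime n q).1 hn
    exact Nat.coprime_two_right.1 (h.coprime_dvd_right ⟨2 * a * (∏ i, D i).natAbs, by rw [hq]; ring⟩)
  have hcopJ : ∀ (J : Finset (Fin I)) (c : (ZMod q)ˣ),
      Int.gcd (∏ j ∈ J, D j) (c : ZMod q).val = 1 := fun J c ↦ by
    have h := (ZMod.val_coe_unit_coprime c).coprime_dvd_right ((Dvd.intro_left 4 rfl).trans (hJq J))
    rw [Int.gcd, Int.natAbs_natCast]
    exact h.symm
  set χ : Finset (Fin I) → (ZMod q)ˣ → ℤ := fun J c ↦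
    jacobiSym (∏ j ∈ J, D j) (c : ZMod q).val with hχ
  have hnat : ∀ (J : Finset (Fin I)) (n : ℕ) (c : (ZMod q)ˣ), (n : ZMod q) = c →
      jacobiSym (∏ j ∈ J, D j) n = χ J c := fun J n c hn ↦ by
    refine jacobiSym_congr_right (hodd _ (hn ▸ c.isUnit))
      (hodd _ (by rw [ZMod.natCast_zmod_val]; exact c.isUnit)) (Nat.ModEq.of_dvd (hJq J) ?_)
    rw [← ZMod.natCast_eq_natCast_iff, hn, ZMod.natCast_zmod_val]
  have hval0 : ∀ c : (ZMod q)ˣ, (c : ZMod q).val ≠ 0 := fun c ↦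
    (hodd _ (by rw [ZMod.natCast_zmod_val]; exact c.isUnit)).pos.ne'
  have hmul : ∀ J u c, χ J (u * c) = χ J u * χ J c := fun J u c ↦ by
    rw [← hnat J ((u : ZMod q).val * (c : ZMod q).val) (u * c) (by simp),
      jacobiSym.mul_right' _ (hval0 u) (hval0 c)]
  have hprod : ∀ J c, χ J c = ∏ j ∈ J, χ {j} c := fun J c ↦ by
    simp only [hχ, prod_singleton]
    induction J using Finset.induction_on with
    | empty => simp
    | insert i J hi ih => rw [prod_insert hi, prod_insert hi, jacobiSym.mul_left, ih]
  have hD4J : ∀ J : Finset (Fin I), (∏ j ∈ J, D j) % 4 = 0 ∨ (∏ j ∈ J, D j) % 4 = 1 := fun J ↦ by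
    induction J using Finset.induction_on with
    | empty => simp
    | insert i J hi ih =>
      rw [prod_insert hi, Int.mul_emod]
      rcases hD4 i with h | h <;> rcases ih with h' | h' <;> simp [h, h']
  set β := ZMod.unitOfCoprime b hab with hβ
  set S : Finset (ZMod q)ˣ := univ.filter fun c ↦ ZMod.unitsMap haq c = β with hS
  have hSne : (#S : ℤ) ≠ 0 := by
    obtain ⟨c, hc⟩ := ZMod.unitsMap_surjective haq β
    exact_mod_cast card_ne_zero_of_mem (a := c) (by simp [hS, hc])
  have hsumS : ∀ J, ∑ c ∈ S, χ J c = if IsSquare (∏ j ∈ J, D j) then (#S : ℤ) else 0 := fun J ↦ by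
    split_ifs with hsq
    · obtain ⟨w, hw⟩ := hsq
      have h1 : ∀ c, χ J c = 1 := fun c ↦ by
        have h2 := hcopJ J c
        simp only [hχ]
        rw [hw, ← pow_two] at h2 ⊢
        refine jacobiSym.sq_one' ?_
        rw [← Int.isCoprime_iff_gcd_eq_one] at h2 ⊢
        exact (IsCoprime.pow_left_iff two_pos).1 h2
      simp [h1]
    · obtain ⟨p, hp, hpq, hpa, hj⟩ := exists_prime_jacobiSym_eq_neg_one hsq (hD4J J) ha
        (hcop.of_isCoprime_of_dvd_right (prod_dvd_prod_of_subset _ _ _ (subset_univ J))) q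
      have hpc : p.Coprime q := hp.coprime_iff_not_dvd.2
        (Nat.not_dvd_of_pos_of_lt (Nat.pos_of_ne_zero hq0) hpq)
      set u := ZMod.unitOfCoprime p hpc with hu
      have huJ : χ J u = -1 := by
        rw [← hj, hnat J p u (by simp [hu])]
      have hua : ZMod.unitsMap haq u = 1 := by
        ext
        rw [ZMod.unitsMap_val, hu, ZMod.coe_unitOfCoprime, ZMod.cast_natCast haq,
          (ZMod.natCast_eq_natCast_iff _ _ _).2 hpa]
        simp
      -- Multiplication by `u` permutes the fibre `S` and negates `χ J`, so the sum equals its own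
      -- negative.
      have hshift : ∑ c ∈ S, χ J c = ∑ c ∈ S, χ J (u * c) :=
        (sum_equiv (Equiv.mulLeft u) (fun c ↦ by simp [hS, map_mul, hua]) fun c _ ↦ rfl).symm
      simp only [hmul, huJ, ← mul_sum] at hshift
      linarith
  have htotal : ∑ c ∈ S, ∏ i, (1 - χ {i} c) = #S * squareSubsetSum D := by
    have h1 : ∀ c, ∏ i, (1 - χ {i} c) = ∑ J : Finset (Fin I), (-1) ^ #J * χ J c := fun c ↦ by
      simp only [sub_eq_add_neg]
      rw [prod_one_add, powerset_univ]
      refine sum_congr rfl fun J _ ↦ ?_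
      rw [hprod J c, prod_neg]
    rw [sum_congr rfl fun c _ ↦ h1 c, sum_comm]
    simp only [← mul_sum, hsumS]
    rw [squareSubsetSum, ← add_sum_erase univ _ (mem_univ (∅ : Finset (Fin I))), mul_add, mul_sum]
    congr 1
    · simp
    · rw [sum_filter, ← add_sum_erase univ _ (mem_univ (∅ : Finset (Fin I)))]
      rw [if_neg (by simp), zero_add]
      refine sum_congr rfl fun J hJ ↦ ?_
      have hJne : J.Nonempty := nonempty_iff_ne_empty.2 (ne_of_mem_erase hJ)
      by_cases hsq : IsSquare (∏ j ∈ J, D j)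
      · simp [hJne, hsq, mul_comm]
      · simp [hsq]
  obtain ⟨c, hcS, hc⟩ := exists_ne_zero_of_sum_ne_zero
    (htotal.trans_ne (mul_ne_zero hSne hD))
  refine ⟨q, hq0, c, c.isUnit, fun p hpc ↦ ⟨?_, fun i ↦ ?_⟩⟩
  · have h1 : ZMod.unitsMap haq c = β := (mem_filter.1 hcS).2
    have h2 := congrArg Units.val h1
    rw [ZMod.unitsMap_val, ← hpc, ZMod.cast_natCast haq, hβ, ZMod.coe_unitOfCoprime] at h2
    exact (ZMod.natCast_eq_natCast_iff _ _ _).1 h2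
  · have h1 := prod_ne_zero_iff.1 hc i (mem_univ i)
    have h2 := hnat {i} p c hpc
    have h3 := hcopJ {i} c
    rw [prod_singleton] at h2 h3
    rw [h2]
    refine (jacobiSym.eq_one_or_neg_one (hcopJ {i} c)).resolve_left fun h4 ↦ h1 ?_
    exact sub_eq_zero.2 h4.symm

/-! ### Discriminants of the quadratic factors. -/

lemma discr_of_natDegree_eq_two {f : ℤ[X]} (hf : f.natDegree = 2) :
    f.discr = f.coeff 1 ^ 2 - 4 * f.coeff 0 * f.coeff 2 :=
  discr_of_degree_eq_two (by rw [degree_eq_natDegree (by rintro rfl; simp at hf), hf]; rfl)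

lemma discr_emod_four {f : ℤ[X]} (hf : f.natDegree = 2) : f.discr % 4 = 0 ∨ f.discr % 4 = 1 := by
  rw [discr_of_natDegree_eq_two hf, mul_assoc]
  rcases Int.even_or_odd (f.coeff 1) with h | h
  · obtain ⟨k, hk⟩ := h.two_dvd
    rw [hk, mul_pow]
    omega
  · have := Int.sq_mod_four_eq_one_of_odd h
    omega

lemma discr_ne_zero_of_irreducible {f : ℤ[X]} (hf : f.natDegree = 2)
    (hirr : Irreducible (f.map (Int.castRingHom ℚ))) : f.discr ≠ 0 := by
  intro h
  have hdeg : (f.map (Int.castRingHom ℚ)).natDegree = 2 := by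
    rw [natDegree_map_eq_of_injective (Int.castRingHom ℚ).injective_int, hf]
  have h2 : (f.coeff 2 : ℚ) ≠ 0 := by
    have : f.coeff 2 ≠ 0 := by
      rw [← hf, coeff_natDegree, leadingCoeff_ne_zero]
      rintro rfl
      simp at hf
    exact_mod_cast this
  -- Zero discriminant would give the rational double root `-b / (2a)`.
  refine hirr.not_isRoot_of_natDegree_ne_one (by omega)
    (x := -(f.coeff 1 : ℚ) / (2 * f.coeff 2)) ?_
  rw [discr_of_natDegree_eq_two hf] at h
  have h' : (f.coeff 1 : ℚ) ^ 2 - 4 * f.coeff 0 * f.coeff 2 = 0 := mod_cast h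
  rw [IsRoot.def, eval_eq_sum_range, hdeg]
  simp only [Finset.sum_range_succ, Finset.sum_range_zero, coeff_map, eq_intCast]
  field_simp
  linear_combination (-(1 : ℚ)) * h'

lemma four_mul_coeff_mul_eval {f : ℤ[X]} (hf : f.natDegree = 2) (n : ℤ) :
    4 * f.coeff 2 * f.eval n = (2 * f.coeff 2 * n + f.coeff 1) ^ 2 - f.discr := by
  rw [discr_of_natDegree_eq_two hf, eval_eq_sum_range, hf]
  simp only [Finset.sum_range_succ, Finset.sum_range_zero]
  ring

/-- A root modulo `p` would exhibit the discriminant as a square. Only this direction is needed, so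
`p` may divide the leading coefficient. -/
lemma not_dvd_eval_of_jacobiSym_discr {f : ℤ[X]} (hf : f.natDegree = 2) {p : ℕ}
    (hj : jacobiSym f.discr p = -1) (n : ℤ) : ¬ (p : ℤ) ∣ f.eval n := by
  intro h
  refine ZMod.nonsquare_of_jacobiSym_eq_neg_one hj
    ⟨((2 * f.coeff 2 * n + f.coeff 1 : ℤ) : ZMod p), ?_⟩
  have h1 := congrArg (Int.cast : ℤ → ZMod p) (four_mul_coeff_mul_eval hf n)
  have h2 := (ZMod.intCast_zmod_eq_zero_iff_dvd _ p).2 h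
  rw [Int.cast_mul, h2, mul_zero, Int.cast_sub, Int.cast_pow] at h1
  rw [← pow_two]
  exact (sub_eq_zero.1 h1.symm).symm

/-! ### Primes near the largest linear value, and what they divide. -/

open Filter in
/-- Primes in a residue class, slightly below the values of a linear function. -/
lemma eventually_exists_prime_linear {q : ℕ} (hq : q ≠ 0) {c : ZMod q} (hc : IsUnit c) {m b : ℤ}
    (hm : 0 < m) :
    ∀ᶠ x : ℕ in atTop, ∃ p : ℕ, p.Prime ∧ (p : ZMod q) = c ∧
      (4 * m - 1) * (m * x + b) ≤ 4 * m * p ∧ (p : ℤ) ≤ m * x + b := by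
  have : NeZero q := ⟨hq⟩
  have hm' : (0 : ℝ) < m := mod_cast hm
  -- Centring the window at `(m x + b) e^(-ε)` puts its top at `m x + b` and its bottom above `(1 -
  -- 2ε)(m x + b)`, where `1 - 2ε = (4m - 1) / (4m)`.
  set ε : ℝ := 1 / (8 * m) with hε
  have hε0 : 0 < ε := by positivity
  have hlin : Tendsto (fun x : ℕ ↦ (m * x + b : ℝ)) atTop atTop :=
    tendsto_atTop_add_const_right _ _ (tendsto_natCast_atTop_atTop.const_mul_atTop hm')
  have h := (hlin.atTop_mul_const (Real.exp_pos (-ε))).eventually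
    (eventually_exists_prime_mem_window hc hε0)
  filter_upwards [h, hlin.eventually_ge_atTop 0] with x ⟨p, hp, hpc, h1, h2⟩ hx
  refine ⟨p, hp, hpc, ?_, ?_⟩
  · have h3 : 1 - 2 * ε ≤ Real.exp (-ε) * Real.exp (-ε) := by
      rw [← Real.exp_add]
      linarith [Real.add_one_le_exp (-ε + -ε)]
    have h4 : (m * x + b : ℝ) * (1 - 2 * ε) ≤ p := by
      refine le_trans ?_ h1
      rw [mul_assoc]
      gcongr
    have h5 : (4 * m - 1 : ℝ) * (m * x + b) = 4 * m * ((m * x + b) * (1 - 2 * ε)) := by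
      rw [hε]
      field_simp
      ring
    have h6 : (4 * m - 1 : ℝ) * (m * x + b) ≤ 4 * m * p := by
      rw [h5]
      gcongr
    exact_mod_cast h6
  · rw [mul_assoc, ← Real.exp_add, neg_add_cancel, Real.exp_zero, mul_one] at h2
    exact_mod_cast h2

lemma not_isSquare_prime_mul {p r : ℤ} (hp : Prime p) (hr : ¬ p ∣ r) : ¬ IsSquare (p * r) := by
  rintro ⟨y, hy⟩
  obtain ⟨z, rfl⟩ : p ∣ y := by
    rcases hp.dvd_or_dvd (hy ▸ dvd_mul_right p r : p ∣ y * y) with h | h <;> exact h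
  refine hr ⟨z * z, mul_left_cancel₀ hp.ne_zero ?_⟩
  rw [hy]
  ring

lemma eq_or_eq_neg_of_dvd_of_abs_lt {p z : ℤ} (hz : z ≠ 0) (hdvd : p ∣ z) (hlt : |z| < 2 * p) :
    z = p ∨ z = -p := by
  rw [abs_lt] at hlt
  rcases lt_or_gt_of_ne hz with h | h
  · right
    have hp : p ≤ -z := Int.le_of_dvd (by omega) ((dvd_neg).2 hdvd)
    have := Int.eq_zero_of_abs_lt_dvd (dvd_add hdvd dvd_rfl : p ∣ z + p)
      (by rw [abs_lt]; omega)
    omega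
  · left
    have hp : p ≤ z := Int.le_of_dvd h hdvd
    have := Int.eq_zero_of_abs_lt_dvd (dvd_sub hdvd dvd_rfl : p ∣ z - p)
      (by rw [abs_lt]; omega)
    omega

lemma mul_le_and_lt_of_linear_window {m b₀ W p : ℤ} {x : ℕ} (hm : 0 < m) (hb₀ : |b₀| ≤ W)
    (hx : 8 * W < x) (hp : (4 * m - 1) * (m * x + b₀) ≤ 4 * m * p) :
    4 * (m * (m * x)) - m * x - 4 * (m * W) + W ≤ 4 * (m * p) ∧
      8 * (m * W) + m ≤ m * x ∧ m * x ≤ m * (m * x) ∧ 0 ≤ m * W ∧ W < p := by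
  have hW : 0 ≤ W := (abs_nonneg b₀).trans hb₀
  have hT : 8 * (m * W) + m ≤ m * x := by
    have := mul_le_mul_of_nonneg_left (by omega : 8 * W + 1 ≤ x) hm.le
    linarith
  have hV : m * x ≤ m * (m * x) := le_mul_of_one_le_left (by positivity) hm
  have hb₀W : 0 ≤ (4 * m - 1) * (b₀ + W) :=
    mul_nonneg (by omega) (by linarith [(abs_le.1 hb₀).1])
  have hU : 0 ≤ m * W := by positivity
  have hPm : 4 * (m * (m * x)) - m * x - 4 * (m * W) + W ≤ 4 * (m * p) := by linarith
  refine ⟨hPm, hT, hV, hU, lt_of_mul_lt_mul_left (?_ : m * _ < m * _) hm.le⟩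
  linarith

/-- A large prime just below `m * x + b₀` divides no dominated linear value in another class. -/
lemma abs_eq_and_eq_of_dvd_linear {m a b b₀ W p : ℤ} {x n : ℕ} (hm : 0 < m) (ham : |a| ≤ m)
    (hb : |b| ≤ W) (hb₀ : |b₀| ≤ W) (hx : 8 * W < x) (hn : 1 ≤ n) (hnx : n ≤ x)
    (hne : a * n + b ≠ 0) (hp : (4 * m - 1) * (m * x + b₀) ≤ 4 * m * p)
    (hdvd : p ∣ a * n + b) : |a| = m ∧ a.sign * b ≡ p [ZMOD m] ∧ a.sign * (a * n + b) = p := by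
  have hW : 0 ≤ W := (abs_nonneg b).trans hb
  obtain ⟨hPm, hT, hV, hU, hpW⟩ := mul_le_and_lt_of_linear_window hm hb₀ hx hp
  have habs : |a * n + b| ≤ |a| * x + W := by
    refine (abs_add_le _ _).trans (add_le_add ?_ hb)
    rw [abs_mul, Nat.abs_cast]
    gcongr
  have hlt2 : |a * n + b| < 2 * p := by
    refine lt_of_mul_lt_mul_left (?_ : m * _ < m * _) hm.le
    have : m * |a * n + b| ≤ m * (m * x + W) := by
      gcongr
      exact habs.trans (by gcongr)
    linarith
  -- A smaller slope gives values at most `(m - 1) x + W`, below `p`, since `p` is within about `x /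
  -- 4` of `m x`.
  have ham' : |a| = m := by
    by_contra h
    have h1 : |a| ≤ m - 1 := by omega
    refine hne (Int.eq_zero_of_abs_lt_dvd hdvd ?_)
    refine lt_of_mul_lt_mul_left (?_ : m * _ < m * _) hm.le
    have : m * |a * n + b| ≤ m * ((m - 1) * x + W) := by
      gcongr
      exact habs.trans (by gcongr)
    linarith
  have hbW := abs_le.1 hb
  have hmn : 0 ≤ m * n := by positivity
  rcases le_total 0 a with ha | ha
  · rw [abs_of_nonneg ha] at ham'
    subst ham'
    rw [Int.sign_eq_one_of_pos hm, one_mul, one_mul]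
    rcases eq_or_eq_neg_of_dvd_of_abs_lt hne hdvd hlt2 with h | h
    · exact ⟨abs_of_pos hm, (Int.modEq_iff_dvd.2 ⟨n, by linarith⟩), h⟩
    -- The value `-p` is impossible: `m n + b ≥ -W > -p`.
    · linarith
  · rw [abs_of_nonpos ha] at ham'
    have ha' : a = -m := by omega
    subst ha'
    rw [Int.sign_eq_neg_one_of_neg (by omega)]
    rcases eq_or_eq_neg_of_dvd_of_abs_lt hne hdvd hlt2 with h | h
    · linarith
    · exact ⟨by rw [abs_neg, abs_of_pos hm], (Int.modEq_iff_dvd.2 ⟨n, by linarith⟩), by linarith⟩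

theorem mainTheorem9 {I K : ℕ}
    (f : Fin I → ℤ[X])
    (hf_deg : ∀ i, (f i).natDegree = 2)
    (hf_irr : ∀ i, Irreducible ((f i).map (Int.castRingHom ℚ)))
    (hf_inj : Function.Injective f)
    (g : Fin (K + 1) → ℤ[X]) (a b : Fin (K + 1) → ℤ)
    (hg : ∀ k, g k = C (a k) * X + C (b k))
    (hg_inj : Function.Injective g)
    (ha : ∀ k, a k ≠ 0) (hb : ∀ k, b k ≠ 0)
    (hab : ∀ k, IsCoprime (a k) (b k))
    (hg_ne : ∀ k, ∀ n : ℕ, 1 ≤ n → (g k).eval (n : ℤ) ≠ 0)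
    (hJ : squareSubsetSum (fun i => (f i).discr) ≠ 0)
    (ha_pos : 0 < a 0)
    (ha_max : ∀ k, |a k| ≤ a 0)
    (ha_coprime : IsCoprime (a 0) (∏ i, (f i).discr))
    (hb_mod : ∀ k, k ≠ 0 → |a k| = a 0 → ¬ b 0 ≡ (a k).sign * b k [ZMOD a 0]) :
    {x : ℕ | 1 ≤ x ∧ IsSquare (productUpTo f g x)}.Finite := by
  have hgev : ∀ k (n : ℕ), (g k).eval (n : ℤ) = a k * n + b k := fun k n ↦ by simp [hg]
  obtain ⟨m, hm⟩ := Int.eq_ofNat_of_zero_le ha_pos.le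
  have hm0 : m ≠ 0 := by
    rintro rfl
    simp [hm] at ha_pos
  obtain ⟨β, hβ⟩ := Int.eq_ofNat_of_zero_le (Int.emod_nonneg (b 0) ha_pos.ne')
  have hβb : (β : ℤ) ≡ b 0 [ZMOD a 0] := by
    rw [← hβ]
    exact Int.mod_modEq _ _
  have hβm : β.Coprime m := by
    rw [← Nat.isCoprime_iff_coprime, ← hm, ← hβ]
    obtain ⟨u, v, huv⟩ := hab 0
    refine ⟨v, u + v * (b 0 / a 0), ?_⟩
    have := Int.emod_add_mul_ediv (b 0) (a 0)
    linear_combination huv + v * this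
  obtain ⟨q, hq, c, hc, hcp⟩ := exists_unit_forall_jacobiSym_eq_neg_one
    (fun i ↦ discr_ne_zero_of_irreducible (hf_deg i) (hf_irr i))
    (fun i ↦ discr_emod_four (hf_deg i)) hJ hm0 (by rwa [← hm]) hβm
  set W := ∑ k, |b k| with hW
  have hbW : ∀ k, |b k| ≤ W := fun k ↦
    Finset.single_le_sum (f := fun k ↦ |b k|) (fun _ _ ↦ abs_nonneg _) (Finset.mem_univ k)
  obtain ⟨x₀, hx₀⟩ := Filter.eventually_atTop.1
    ((eventually_exists_prime_linear hq hc (b := b 0) ha_pos).and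
      (Filter.eventually_gt_atTop (8 * W).toNat))
  refine (Set.finite_Iio x₀).subset fun x ⟨_, hsq⟩ ↦ ?_
  by_contra hx
  obtain ⟨⟨p, hp, hpc, hlow, hup⟩, hxW⟩ := hx₀ x (not_lt.1 hx)
  have hxW' : 8 * W < x := by omega
  obtain ⟨hpβ, hj⟩ := hcp p hpc
  have hpb : b 0 ≡ p [ZMOD a 0] := by
    refine hβb.symm.trans ?_
    rw [hm]
    exact (Int.natCast_modEq_iff.2 hpβ).symm
  have hpZ : Prime (p : ℤ) := Nat.prime_iff_prime_int.1 hp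
  have key : ∀ k, ∀ n ∈ Finset.Icc 1 x, (p : ℤ) ∣ (g k).eval (n : ℤ) →
      k = 0 ∧ a 0 * n + b 0 = p := by
    intro k n hn hdvd
    rw [Finset.mem_Icc] at hn
    have hne := hg_ne k n hn.1
    rw [hgev] at hdvd hne
    obtain ⟨h1, h2, h3⟩ := abs_eq_and_eq_of_dvd_linear ha_pos (ha_max k) (hbW k) (hbW 0) hxW'
      hn.1 hn.2 hne hlow hdvd
    have hk : k = 0 := by
      by_contra hk
      exact hb_mod k hk h1 (hpb.trans h2.symm)
    subst hk
    rw [Int.sign_eq_one_of_pos ha_pos, one_mul] at h3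
    exact ⟨rfl, h3⟩
  -- Here `w = (p - b 0) / a 0`; the bounds `b 0 < p ≤ a 0 * x + b 0` place it in `[1, x]`.
  obtain ⟨w, hw⟩ := Int.modEq_iff_dvd.1 hpb
  have hpb0 : b 0 < p := (le_abs_self _).trans_lt ((hbW 0).trans_lt
    (mul_le_and_lt_of_linear_window ha_pos (hbW 0) hxW' hlow).2.2.2.2)
  have hw1 : 0 < w := pos_of_mul_pos_right (by linarith : 0 < a 0 * w) ha_pos.le
  have hwx : w ≤ x := le_of_mul_le_mul_left (by linarith : a 0 * w ≤ a 0 * x) ha_pos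
  lift w to ℕ using hw1.le
  have hwmem : w ∈ Finset.Icc 1 x := Finset.mem_Icc.2 ⟨by omega, by omega⟩
  have hg0 : (g 0).eval (w : ℤ) = p := by rw [hgev]; linarith
  have hfactor : productUpTo f g x = p * ((∏ i, (f i).eval (w : ℤ)) *
      (∏ k ∈ Finset.univ.erase 0, (g k).eval (w : ℤ)) *
      ∏ n ∈ (Finset.Icc 1 x).erase w,
        (∏ i, (f i).eval (n : ℤ)) * ∏ k, (g k).eval (n : ℤ)) := by
    rw [productUpTo, ← Finset.mul_prod_erase _ _ hwmem,
      ← Finset.mul_prod_erase Finset.univ (fun k ↦ (g k).eval (w : ℤ)) (Finset.mem_univ 0), hg0]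
    ring
  rw [hfactor] at hsq
  have hfdvd : ∀ n : ℤ, ¬ (p : ℤ) ∣ ∏ i, (f i).eval n := fun n h ↦ by
    obtain ⟨i, _, hi⟩ := hpZ.exists_mem_finset_dvd h
    exact not_dvd_eval_of_jacobiSym_discr (hf_deg i) (hj i) n hi
  refine not_isSquare_prime_mul hpZ (fun h ↦ ?_) hsq
  rcases hpZ.dvd_or_dvd h with h | h
  · rcases hpZ.dvd_or_dvd h with h | h
    · exact hfdvd _ h
    · obtain ⟨k, hk, hdvd⟩ := hpZ.exists_mem_finset_dvd h
      exact Finset.ne_of_mem_erase hk (key k w hwmem hdvd).1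
  · obtain ⟨n, hn, hdvd⟩ := hpZ.exists_mem_finset_dvd h
    rcases hpZ.dvd_or_dvd hdvd with h | h
    · exact hfdvd _ h
    · obtain ⟨k, _, hk⟩ := hpZ.exists_mem_finset_dvd h
      have h1 := (key k n (Finset.mem_of_mem_erase hn) hk).2
      have h2 : a 0 * (n : ℤ) = a 0 * w := by linarith
      exact Finset.ne_of_mem_erase hn (Int.natCast_inj.1 (mul_left_cancel₀ ha_pos.ne' h2))
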